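/- Let $p$ be a prime, let $k$ be a field of characteristic $p$ and let $K/k$ be a purely inseparable extension. For an extension $F'/F$ of fields of characteristic $p$, an $r$-base of $F'/F$ is a subset $B\subseteq F'$ with $F'=F(F'^p)(B)$ and $x\notin F(F'^p)(B\setminus\{x\})$ for all $x\in B$ (it exists and its cardinality is an invariant of $F'/F$). For $n\in\mathbb N$ put $k_n=\{x\in K : x^{p^n}\in k\}$; the degree of irrationality $di(K/k)$ is the supremum over $n$ of the cardinalities of $r$-bases of $k_n/k$, and $K/k$ is called $q$-finite if $di(K/k)$ is finite. For an intermediate field $L$, the extension $K/L$ is called modular if for every $n\in\mathbb N$ the fields $K^{p^n}$ and $L$ are linearly disjoint over $K^{p^n}\cap L$; it has bounded exponent if $K^{p^e}\subseteq L$ for some $e\in\mathbb N$, and unbounded exponent otherwise. **Theorem.** Let $K/k$ be $q$-finite. Then among the intermediate fields $L$ of $K/k$ with $K/L$ modular there is a smallest one, $M$. If $K\neq k$, then $M\neq K$. More precisely, if $K/k$ has unbounded exponent, then so does $K/M$. -/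

import Mathlib

universe u v

namespace PurelyInsep

section Generators

variable (k : Type u) (K : Type v) [Field k] [Field K] [Algebra k K]

/-- `G` is a minimal `r`-generator of `K/k`: `K = k(G)` and `x ∉ k(G \ {x})` for all `x ∈ G`. -/
def IsMinimalRGenerator (G : Set K) : Prop :=
  IntermediateField.adjoin k G = ⊤ ∧ ∀ x ∈ G, x ∉ IntermediateField.adjoin k (G \ {x})

/-- The intermediate field `k(K ^ p)` of `K/k`. -/
def adjoinPowers (p : ℕ) : IntermediateField k K :=
  IntermediateField.adjoin k (Set.range fun x : K => x ^ p)

/-- `B` is an `r`-base of `K/k`: a minimal `r`-generator of `K/k(K ^ p)`. -/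
def IsRBase (p : ℕ) (B : Set K) : Prop :=
  IsMinimalRGenerator (adjoinPowers k K p) K B

/-- The cardinality of an `r`-base of `K/k` (every extension of characteristic `p > 0` has an
`r`-base, and all `r`-bases of one extension have the same cardinality). -/
noncomputable def rBaseCard (p : ℕ) : Cardinal.{v} :=
  sInf {c | ∃ B : Set K, IsRBase k K p B ∧ Cardinal.mk B = c}

end Generators

section Exponent

variable (k : Type u) (K : Type v) [Field k] [Field K] [Algebra k K]
variable (p : ℕ) [Fact p.Prime] [CharP K p]

/-- The intermediate field `k ^ (p ^ (-n)) ∩ K` of `K/k`, i.e. the set of all `x ∈ K` with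
`x ^ (p ^ n) ∈ k`. -/
def rootField (n : ℕ) : IntermediateField k K :=
  { ((algebraMap k K).fieldRange.comap (iterateFrobenius K p n) : Subfield K) with
    algebraMap_mem' := fun a => ⟨a ^ p ^ n, by simp [iterateFrobenius_def]⟩ }

theorem mem_rootField {n : ℕ} {x : K} :
    x ∈ rootField k K p n ↔ x ^ p ^ n ∈ (algebraMap k K).range :=
  Iff.rfl

/-- The degree of irrationality `di(K/k)`: the supremum over `n` of the cardinalities of
`r`-bases of `(k ^ (p ^ (-n)) ∩ K)/k`. -/
noncomputable def di : Cardinal.{v} :=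
  ⨆ n : ℕ, rBaseCard k (rootField k K p n) p

/-- `K/k` is `q`-finite: its degree of irrationality is finite. -/
def IsQFinite : Prop :=
  di k K p < Cardinal.aleph0

end Exponent

section Modular

/-- Two subfields `A` and `B` of `K` are linearly disjoint over `A ∩ B`. -/
def LinearDisjointOverInf {K : Type v} [Field K] (A B : Subfield K) : Prop :=
  (Subfield.extendScalars (inf_le_left : A ⊓ B ≤ A)).LinearDisjoint
    (Subfield.extendScalars (inf_le_right : A ⊓ B ≤ B))

/-- `K/k` is modular: for every `n`, the subfields `K ^ (p ^ n)` and `k` of `K` are linearly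
disjoint over their intersection. -/
def IsModular (k : Type u) (K : Type v) [Field k] [Field K] [Algebra k K]
    (p : ℕ) [Fact p.Prime] [CharP K p] : Prop :=
  ∀ n : ℕ, LinearDisjointOverInf (iterateFrobenius K p n).fieldRange (algebraMap k K).fieldRange

end Modular

end PurelyInsep

/-!
Everything takes place in the lattice of subfields of `K`, with degrees measured by
`Subfield.relfinrank`. Write `φ` for the Frobenius, `E ^ (p ^ n)` for `φ ^ n` applied to `E`, and
`k_n` for the field of all `x` with `x ^ (p ^ n) ∈ k`.

*Existence of `M`.* A field `A` that is linearly disjoint from each member of a family of fields is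
linearly disjoint from their intersection (`linearDisjointOverInf_sInf`). Hence the intersection
`M` of all `L` with `K / L` modular belongs to this family. To bound `M` from above it suffices to
produce one suitable `L`.

*Bounded exponent.* Here `L = k(K ^ p)` is proper if `k ≠ K`, and `K / L` is modular because
`K ^ p ⊆ L`.

*Unbounded exponent.* `q`-finiteness bounds the degrees `[E : k(E ^ p)]` of all finite
subextensions `E / k` by some `N` (`IsQFinite.exists_rDegBounded`), and this bound is inherited when
`k` is enlarged. After a finite extension of `k` one has `K = k(K ^ p)`
(`RDegBounded.exists_relPerfect`); then `K / L` has unbounded exponent for every `L ≠ K`, and it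
remains to find `L ≠ K` with `K / L` modular (`exists_modular_of_relPerfect`). This goes by
induction on `N`.

For fixed `i`, the fields `k(k_{n+i} ^ (p ^ n))` decrease with `n` inside the finite extension
`k_i / k`, so they stabilise to a field `F_i`, the `core`. These satisfy `F_0 = k` and
`k(F_{i+1} ^ p) = F_i`, so the degrees `[F_{i+1} : F_i]` increase with `i` and are at most `N`. They
are therefore eventually constant, equal to some `c`, and `c ≥ 2`. Let `F` be the union of the
`F_i`.

If `F = K`, then over `F_i` with `i` large `K` is the union of a tower with constant degrees, and
counting degrees shows that `K / F_i` is modular (`linearDisjointOverInf_of_tower`). If `F ≠ K`, the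
degrees `[E : F(E ^ p)]` for `E / F` finite are all less than `N` (`rdeg_lt_of_coreUnion_le`), and
the induction hypothesis applies to `K / F`. For otherwise, given `j`, for `n` large each of the
first `j` steps of the chain `F_n(k_n ^ (p ^ i))`, `i = 0, 1, …, n`, from `k_n` down to `F_n`, has
degree at least `N`, hence at least the degree of the corresponding step of `k(k_n ^ (p ^ i))`. At
each of the other steps its degree is smaller at most by the factor `c`. Thus
`[k_n : F_n] c ^ (n - j) ≥ [k_n : k]`, whereas `[F_n : k]` is `c ^ n` up to a bounded factor; for
large `j` this is absurd.
-/

namespace PurelyInsep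

/-! ### Degrees of subfields -/

section Degrees

variable {K : Type v} [Field K] {A B C k : Subfield K}

theorem relfinrank_left_ne_zero (hAB : A ≤ B) (hBC : B ≤ C) (h : A.relfinrank C ≠ 0) :
    A.relfinrank B ≠ 0 :=
  left_ne_zero_of_mul (Subfield.relfinrank_mul_relfinrank hAB hBC ▸ h)

theorem relfinrank_right_ne_zero (hAB : A ≤ B) (hBC : B ≤ C) (h : A.relfinrank C ≠ 0) :
    B.relfinrank C ≠ 0 :=
  right_ne_zero_of_mul (Subfield.relfinrank_mul_relfinrank hAB hBC ▸ h)

theorem eq_of_relfinrank_le (hAB : A ≤ B) (hBC : B ≤ C) (h : A.relfinrank C ≠ 0)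
    (hle : A.relfinrank C ≤ A.relfinrank B) : B = C := by
  have h1 := Subfield.relfinrank_mul_relfinrank hAB hBC
  have h2 := relfinrank_left_ne_zero hAB hBC h
  have h3 := relfinrank_right_ne_zero hAB hBC h
  have h4 : B.relfinrank C ≤ 1 := by
    refine Nat.le_of_mul_le_mul_left (c := A.relfinrank B) ?_ (Nat.pos_of_ne_zero h2)
    omega
  exact le_antisymm hBC (Subfield.relfinrank_eq_one_iff.1 (by omega))

theorem finiteDimensional_extendScalars (hAB : A ≤ B) (h : A.relfinrank B ≠ 0) :
    FiniteDimensional A (Subfield.extendScalars hAB) := by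
  rw [Subfield.relfinrank_eq_finrank_of_le hAB] at h
  exact Module.finite_of_finrank_pos (Nat.pos_of_ne_zero h)

/-- Translating a finite extension `A / B` by a field `C` does not increase its degree. -/
theorem relfinrank_sup_le (hBA : B ≤ A) (h : B.relfinrank A ≠ 0) (C : Subfield K) :
    (B ⊔ C).relfinrank (A ⊔ C) ≠ 0 ∧ (B ⊔ C).relfinrank (A ⊔ C) ≤ B.relfinrank A := by
  have := finiteDimensional_extendScalars hBA h
  let _ : Algebra B ↥(B ⊔ C) := (Subfield.inclusion (le_sup_left : B ≤ B ⊔ C)).toAlgebra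
  have : IsScalarTower B ↥(B ⊔ C) K := IsScalarTower.of_algebraMap_eq fun _ => rfl
  have hle : B ⊔ C ≤ A ⊔ C := sup_le_sup_right hBA C
  have hrank := IntermediateField.adjoin_rank_le_of_isAlgebraic_right ↥(B ⊔ C)
    (Subfield.extendScalars hBA)
  have heq : IntermediateField.adjoin ↥(B ⊔ C) (Subfield.extendScalars hBA : Set K)
      = Subfield.extendScalars hle := by
    apply le_antisymm
    · rw [IntermediateField.adjoin_le_iff]
      intro x hx
      exact (le_sup_left : A ≤ A ⊔ C) hx
    · rw [Subfield.extendScalars_le_iff]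
      refine sup_le (fun x hx => IntermediateField.subset_adjoin _ _ hx) (fun x hx => ?_)
      exact IntermediateField.algebraMap_mem _ (⟨x, (le_sup_right : C ≤ B ⊔ C) hx⟩ : ↥(B ⊔ C))
  rw [heq] at hrank
  have hfin : Module.Finite ↥(B ⊔ C) (Subfield.extendScalars hle) :=
    Module.rank_lt_aleph0_iff.1 (hrank.trans_lt (Module.rank_lt_aleph0 _ _))
  rw [Subfield.relfinrank_eq_finrank_of_le hle, Subfield.relfinrank_eq_finrank_of_le hBA]
  refine ⟨Module.finrank_pos.ne', ?_⟩
  rw [← Module.finrank_eq_rank, ← Module.finrank_eq_rank] at hrank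
  exact_mod_cast hrank

theorem relfinrank_sup_ne_zero (hA : k ≤ A) (hB : k ≤ B) (h1 : k.relfinrank A ≠ 0)
    (h2 : k.relfinrank B ≠ 0) : k.relfinrank (A ⊔ B) ≠ 0 := by
  rw [← Subfield.relfinrank_mul_relfinrank hA (le_sup_left : A ≤ A ⊔ B)]
  have := (relfinrank_sup_le hB h2 A).1
  rw [sup_eq_right.2 hA, sup_comm] at this
  exact mul_ne_zero h1 this

theorem adjoin_eq_extendScalars (k : Subfield K) (S : Set K) :
    IntermediateField.adjoin k S
      = Subfield.extendScalars (le_sup_left : k ≤ k ⊔ Subfield.closure S) := by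
  apply le_antisymm
  · rw [IntermediateField.adjoin_le_iff]
    intro x hx
    exact (le_sup_right : _ ≤ k ⊔ Subfield.closure S) (Subfield.subset_closure hx)
  · rw [Subfield.extendScalars_le_iff]
    refine sup_le (fun x hx => IntermediateField.algebraMap_mem _ (⟨x, hx⟩ : k)) ?_
    rw [Subfield.closure_le]
    exact IntermediateField.subset_adjoin _ _

theorem relfinrank_closure_singleton {m : ℕ} (hm : 0 < m) {x : K} (hx : x ^ m ∈ k) :
    k.relfinrank (k ⊔ Subfield.closure {x}) ≠ 0 ∧
      k.relfinrank (k ⊔ Subfield.closure {x}) ≤ m := by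
  rw [Subfield.relfinrank_eq_finrank_of_le le_sup_left, ← adjoin_eq_extendScalars]
  set f : Polynomial k := Polynomial.X ^ m - Polynomial.C ⟨x ^ m, hx⟩ with hf
  have hmon : f.Monic := Polynomial.monic_X_pow_sub_C _ hm.ne'
  have hroot : Polynomial.aeval x f = 0 := by
    simp only [hf, map_sub, map_pow, Polynomial.aeval_X, Polynomial.aeval_C]
    exact sub_self _
  have hint : IsIntegral k x := ⟨f, hmon, by rwa [Polynomial.aeval_def] at hroot⟩
  rw [IntermediateField.adjoin.finrank hint]
  refine ⟨(minpoly.natDegree_pos hint).ne', ?_⟩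
  calc (minpoly k x).natDegree ≤ f.natDegree :=
        Polynomial.natDegree_le_of_dvd (minpoly.dvd k x hroot) hmon.ne_zero
    _ = m := Polynomial.natDegree_X_pow_sub_C

theorem relfinrank_closure_finset {m : ℕ} (hm : 0 < m) (S : Finset K)
    (hS : ∀ x ∈ S, x ^ m ∈ k) :
    k.relfinrank (k ⊔ Subfield.closure S) ≠ 0 ∧
      k.relfinrank (k ⊔ Subfield.closure S) ≤ m ^ S.card := by
  classical
  induction S using Finset.induction_on with
  | empty =>
    have : k ⊔ Subfield.closure ((∅ : Finset K) : Set K) = k := by simp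
    rw [this]
    simp
  | insert x S hxS ih =>
    obtain ⟨h1, h2⟩ := ih fun y hy => hS y (Finset.mem_insert_of_mem hy)
    have hx : x ^ m ∈ k := hS x (Finset.mem_insert_self x S)
    obtain ⟨h3, h4⟩ := relfinrank_closure_singleton hm hx
    have heq : k ⊔ Subfield.closure ((insert x S : Finset K) : Set K)
        = (k ⊔ Subfield.closure {x}) ⊔ (k ⊔ Subfield.closure S) := by
      rw [Finset.coe_insert, Set.insert_eq, Subfield.closure_union, ← sup_sup_distrib_left]
    obtain ⟨h5, h6⟩ := relfinrank_sup_le le_sup_left h3 (k ⊔ Subfield.closure (S : Set K))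
    rw [sup_eq_right.2 (le_sup_left : k ≤ k ⊔ Subfield.closure (S : Set K))] at h5 h6
    rw [heq, ← Subfield.relfinrank_mul_relfinrank
      (le_sup_left : k ≤ k ⊔ Subfield.closure (S : Set K)) le_sup_right]
    refine ⟨mul_ne_zero h1 h5, ?_⟩
    rw [Finset.card_insert_of_notMem hxS, pow_succ]
    exact Nat.mul_le_mul h2 (h6.trans h4)

theorem exists_finset_sup_closure (hkA : k ≤ A) (h : k.relfinrank A ≠ 0) :
    ∃ S : Finset K, A = k ⊔ Subfield.closure S := by
  have := finiteDimensional_extendScalars hkA h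
  obtain ⟨S, hS⟩ :=
    IntermediateField.essFiniteType_iff.1
      (inferInstance : Algebra.EssFiniteType k (Subfield.extendScalars hkA))
  refine ⟨S, ?_⟩
  rw [adjoin_eq_extendScalars] at hS
  have := congrArg IntermediateField.toSubfield hS
  simpa using this.symm

/-- Among the subfields of `X` that are finite over `k` there is one of maximal degree; it absorbs
all others. -/
theorem relfinrank_ne_zero_of_bounded {X : Subfield K} {N : ℕ} (hkX : k ≤ X)
    (halg : ∀ x ∈ X, ∃ m, 0 < m ∧ x ^ m ∈ k)
    (hN : ∀ E, k ≤ E → E ≤ X → k.relfinrank E ≠ 0 → k.relfinrank E ≤ N) :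
    k.relfinrank X ≠ 0 := by
  classical
  let P : ℕ → Prop := fun m => ∃ E, k ≤ E ∧ E ≤ X ∧ k.relfinrank E ≠ 0 ∧ k.relfinrank E = m
  have hP1 : P 1 := ⟨k, le_rfl, hkX, by simp, by simp⟩
  have hN1 : 1 ≤ N := by simpa using hN k le_rfl hkX (by simp)
  obtain ⟨E, hkE, hEX, hE0, hEm⟩ : P (Nat.findGreatest P N) := Nat.findGreatest_spec hN1 hP1
  suffices hXE : X ≤ E by rwa [le_antisymm hXE hEX]
  intro x hx
  obtain ⟨m, hm, hxm⟩ := halg x hx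
  have hS : k ⊔ Subfield.closure {x} ≤ X := by
    refine sup_le hkX ?_
    rw [Subfield.closure_le]
    simpa using hx
  have h0 := relfinrank_sup_ne_zero hkE le_sup_left hE0 (relfinrank_closure_singleton hm hxm).1
  have hle : k ≤ E ⊔ (k ⊔ Subfield.closure {x}) := hkE.trans le_sup_left
  have hmax : k.relfinrank (E ⊔ (k ⊔ Subfield.closure {x})) ≤ k.relfinrank E := by
    rw [hEm]
    exact Nat.le_findGreatest (hN _ hle (sup_le hEX hS) h0)
      ⟨_, hle, sup_le hEX hS, h0, rfl⟩
  rw [eq_of_relfinrank_le hkE le_sup_left h0 hmax]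
  exact (le_sup_right.trans le_sup_right : Subfield.closure {x} ≤ _)
    (Subfield.subset_closure rfl)

end Degrees

/-! ### Powers, roots and the degrees `[E : k(E ^ p)]` -/

section FrobeniusPowers

variable {K : Type v} [Field K] (p : ℕ) [Fact p.Prime] [CharP K p]

/-- The subfield `A ^ (p ^ n)` of all `p ^ n`-th powers of elements of `A`. -/
def pw (n : ℕ) (A : Subfield K) : Subfield K :=
  A.map (iterateFrobenius K p n)

/-- The subfield of all `x ∈ K` with `x ^ (p ^ n) ∈ A`. -/
def rt (n : ℕ) (A : Subfield K) : Subfield K :=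
  A.comap (iterateFrobenius K p n)

variable {p} {A B C k F E : Subfield K} {m n : ℕ}

theorem mem_rt {x : K} : x ∈ rt p n A ↔ x ^ p ^ n ∈ A :=
  Iff.rfl

theorem mem_pw {x : K} : x ∈ pw p n A ↔ ∃ y ∈ A, y ^ p ^ n = x :=
  Iff.rfl

theorem pw_mono (h : A ≤ B) : pw p n A ≤ pw p n B := by
  rintro _ ⟨y, hy, rfl⟩
  exact ⟨y, h hy, rfl⟩

theorem pw_le : pw p n A ≤ A := by
  intro x hx
  obtain ⟨y, hy, rfl⟩ := mem_pw.1 hx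
  exact pow_mem hy _

theorem pw_sup : pw p n (A ⊔ B) = pw p n A ⊔ pw p n B :=
  Subfield.map_sup _ _ _

theorem pw_zero : pw p 0 A = A := by
  ext x
  simp [mem_pw]

theorem pw_pw : pw p m (pw p n A) = pw p (n + m) A := by
  ext x
  simp [mem_pw, pow_add, pow_mul]

theorem pw_antitone (h : m ≤ n) : pw p n A ≤ pw p m A := by
  obtain ⟨d, rfl⟩ := Nat.exists_eq_add_of_le h
  rw [← pw_pw]
  exact pw_le.trans' le_rfl

theorem pw_le_iff : pw p n A ≤ B ↔ A ≤ rt p n B :=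
  Subfield.map_le_iff_le_comap

theorem relfinrank_pw : (pw p n A).relfinrank (pw p n B) = A.relfinrank B :=
  Subfield.relfinrank_map_map _ _ _

theorem le_rt : A ≤ rt p n A :=
  pw_le_iff.1 pw_le

theorem rt_mono (h : m ≤ n) : rt p m A ≤ rt p n A := by
  intro x hx
  obtain ⟨d, rfl⟩ := Nat.exists_eq_add_of_le h
  rw [mem_rt, pow_add, pow_mul]
  exact pow_mem (mem_rt.1 hx) _

theorem sup_pw_sup (h : k ≤ F) : F ⊔ pw p n (k ⊔ A) = F ⊔ pw p n A := by
  rw [pw_sup, ← sup_assoc, sup_eq_left.2 (pw_le.trans h)]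

variable (p) in
/-- The degree of `E` over `k(E ^ p)`; if finite, it is `p` to the size of an `r`-base of `E/k`. -/
noncomputable def rdeg (k E : Subfield K) : ℕ :=
  (k ⊔ pw p 1 E).relfinrank E

/-- This holds because the Frobenius preserves degrees: `[F : E] = [F ^ p : E ^ p]`, which is at least
`[k(F ^ p) : k(E ^ p)]`. -/
theorem rdeg_mono (hkE : k ≤ E) (hEF : E ≤ F) (h : k.relfinrank F ≠ 0) :
    rdeg p k E ≤ rdeg p k F := by
  have hE : k ⊔ pw p 1 E ≤ E := sup_le hkE pw_le
  have hF : k ⊔ pw p 1 F ≤ F := sup_le (hkE.trans hEF) pw_le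
  have hEF' : k ⊔ pw p 1 E ≤ k ⊔ pw p 1 F := sup_le_sup_left (pw_mono hEF) k
  have hEF0 := relfinrank_right_ne_zero hkE hEF h
  have h1 := Subfield.relfinrank_mul_relfinrank hEF' hF
  have h2 := Subfield.relfinrank_mul_relfinrank hE hEF
  have h3 := (relfinrank_sup_le (pw_mono (n := 1) (p := p) hEF)
    (by rwa [relfinrank_pw]) k).2
  rw [relfinrank_pw, sup_comm, sup_comm _ k] at h3
  unfold rdeg
  refine Nat.le_of_mul_le_mul_right (c := E.relfinrank F) ?_ (Nat.pos_of_ne_zero hEF0)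
  rw [h2, ← h1, mul_comm]
  exact Nat.mul_le_mul_left _ h3

theorem rdeg_ne_zero (hkE : k ≤ E) (h : k.relfinrank E ≠ 0) : rdeg p k E ≠ 0 :=
  relfinrank_right_ne_zero le_sup_left (sup_le hkE pw_le) h

theorem rdeg_sup_le (hkF : k ≤ F) (hkE : k ≤ E) (h : k.relfinrank E ≠ 0) :
    rdeg p F (F ⊔ E) ≤ rdeg p k E := by
  have h1 := (relfinrank_sup_le (sup_le hkE pw_le) (rdeg_ne_zero (p := p) hkE h) F).2
  unfold rdeg
  rwa [sup_pw_sup le_rfl, sup_comm F E, show F ⊔ pw p 1 E = k ⊔ pw p 1 E ⊔ F by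
    rw [sup_right_comm, sup_eq_right.2 hkF]]

variable (p) in
/-- The degrees `[E : k(E ^ p)]`, for `E` finite over `k`, are at most `N`. -/
def RDegBounded (k : Subfield K) (N : ℕ) : Prop :=
  ∀ E, k ≤ E → k.relfinrank E ≠ 0 → rdeg p k E ≤ N

variable (p) in
/-- `K` is purely inseparable over the subfield `k`. -/
def IsPI (k : Subfield K) : Prop :=
  ∀ x : K, ∃ n, x ^ p ^ n ∈ k

omit [Fact p.Prime] [CharP K p] in
theorem IsPI.mono (h : IsPI p k) (hkF : k ≤ F) : IsPI p F :=
  fun x => (h x).imp fun _ hn => hkF hn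

theorem p_pow_pos : 0 < p ^ n := pow_pos (Fact.out : p.Prime).pos n

theorem IsPI.relfinrank_closure_ne_zero (h : IsPI p k) (S : Finset K) :
    k.relfinrank (k ⊔ Subfield.closure S) ≠ 0 := by
  choose f hf using h
  refine (relfinrank_closure_finset (m := p ^ (S.sup f)) p_pow_pos S fun x hx => ?_).1
  exact rt_mono (A := k) (Finset.le_sup hx) (hf x)

/-- A finite extension of `F` comes from a finite extension of any smaller base field `k`. -/
theorem IsPI.exists_eq_sup (h : IsPI p k) (hkF : k ≤ F) (hFE : F ≤ E)
    (h0 : F.relfinrank E ≠ 0) : ∃ D, k ≤ D ∧ k.relfinrank D ≠ 0 ∧ E = F ⊔ D := by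
  obtain ⟨S, hS⟩ := exists_finset_sup_closure hFE h0
  refine ⟨_, le_sup_left, h.relfinrank_closure_ne_zero S, ?_⟩
  rw [hS, ← sup_assoc, sup_eq_left.2 hkF]

/-- Bounds on the degrees `[E : k(E ^ p)]` are inherited by larger base fields. -/
theorem RDegBounded.mono_left {N : ℕ} (hN : RDegBounded p k N) (h : IsPI p k) (hkF : k ≤ F) :
    RDegBounded p F N := by
  intro E hFE h0
  obtain ⟨D, hkD, hD0, rfl⟩ := h.exists_eq_sup hkF hFE h0
  exact (rdeg_sup_le hkF hkD hD0).trans (hN D hkD hD0)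

/-- The steps of the chain `k(E ^ (p ^ n))` are themselves degrees of the form `[E' : k(E' ^ p)]`. -/
theorem rdeg_sup_pw : rdeg p k (k ⊔ pw p n E)
    = (k ⊔ pw p (n + 1) E).relfinrank (k ⊔ pw p n E) := by
  unfold rdeg
  rw [sup_pw_sup le_rfl, pw_pw]

theorem sup_pw_antitone (h : m ≤ n) : k ⊔ pw p n E ≤ k ⊔ pw p m E :=
  sup_le_sup_left (pw_antitone h) k

theorem relfinrank_sup_pw_le {N : ℕ} (hN : RDegBounded p k N) (hkE : k ≤ E)
    (h0 : k.relfinrank E ≠ 0) (n : ℕ) : (k ⊔ pw p n E).relfinrank E ≤ N ^ n := by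
  induction n with
  | zero => simp [pw_zero, sup_eq_right.2 hkE]
  | succ n ih =>
    have hE : k ⊔ pw p n E ≤ E := sup_le hkE pw_le
    rw [← Subfield.relfinrank_mul_relfinrank (sup_pw_antitone n.le_succ) hE, ← rdeg_sup_pw,
      pow_succ, mul_comm]
    exact Nat.mul_le_mul ih (hN _ le_sup_left (relfinrank_left_ne_zero le_sup_left hE h0))

/-- If the degrees `[E : k(E ^ p)]` are bounded, the fields `k ^ (p ^ (-n)) ∩ K` are finite over
`k`. -/
theorem RDegBounded.relfinrank_rt_ne_zero {N : ℕ} (hN : RDegBounded p k N) (n : ℕ) :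
    k.relfinrank (rt p n k) ≠ 0 := by
  refine relfinrank_ne_zero_of_bounded (N := N ^ n) le_rt (fun x hx => ⟨p ^ n, p_pow_pos, hx⟩) ?_
  intro E hkE hE h0
  have := relfinrank_sup_pw_le hN hkE h0 n
  rwa [sup_eq_left.2 (pw_le_iff.2 hE)] at this

/-- After a finite extension `E` of the base field, `K` becomes relatively perfect: `K = E(K ^ p)`. -/
theorem RDegBounded.exists_relPerfect {N : ℕ} (hN : RDegBounded p k N) (h : IsPI p k) :
    ∃ E, k ≤ E ∧ k.relfinrank E ≠ 0 ∧ E ⊔ pw p 1 ⊤ = ⊤ := by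
  set R := k ⊔ pw p 1 (⊤ : Subfield K)
  have hR0 : R.relfinrank ⊤ ≠ 0 := by
    refine relfinrank_ne_zero_of_bounded (N := N) le_top
      (fun x _ => ⟨p ^ 1, p_pow_pos, (le_sup_right : _ ≤ R) ⟨x, trivial, rfl⟩⟩) ?_
    intro E hRE _ hE0
    obtain ⟨D, hkD, hD0, rfl⟩ := h.exists_eq_sup le_sup_left hRE hE0
    have h1 := (relfinrank_sup_le (sup_le hkD pw_le) (rdeg_ne_zero (p := p) hkD hD0) R).2
    rw [sup_eq_right.2 (sup_le_sup_left (pw_mono le_top) k : k ⊔ pw p 1 D ≤ R), sup_comm D] at h1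
    exact h1.trans (hN D hkD hD0)
  obtain ⟨E, hkE, hE0, hE⟩ := h.exists_eq_sup le_sup_left le_top hR0
  refine ⟨E, hkE, hE0, ?_⟩
  rw [eq_comm, sup_right_comm, sup_eq_right.2 hkE] at hE
  exact hE

theorem sup_pw_top_eq_top (h : k ⊔ pw p 1 ⊤ = ⊤) (n : ℕ) : k ⊔ pw p n ⊤ = ⊤ := by
  induction n with
  | zero => simp [pw_zero]
  | succ n ih =>
    have := sup_pw_sup (p := p) (n := n) (A := pw p 1 ⊤) (le_refl k)
    rwa [h, ih, pw_pw, add_comm, eq_comm] at this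

/-- A relatively perfect extension of bounded exponent is trivial. -/
theorem eq_top_of_pw_le (h : k ⊔ pw p 1 ⊤ = ⊤) (hn : pw p n ⊤ ≤ k) : k = ⊤ := by
  rw [← sup_pw_top_eq_top h n, sup_eq_left.2 hn]

end FrobeniusPowers

/-! ### Linear disjointness -/

section LinearDisjointness

variable {K : Type v} [Field K] {A B D : Subfield K}

theorem linearDisjoint_iff_forall_finset {D K : Type*} [Field D] [Field K] [Algebra D K]
    (X Y : IntermediateField D K) :
    X.LinearDisjoint Y ↔
      ∀ s : Finset K, (∀ x ∈ s, x ∈ X) → LinearIndepOn D id (s : Set K) →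
        LinearIndepOn Y id (s : Set K) := by
  constructor
  · intro h s hs hi
    let a : ↥(s : Set K) → X := fun x => ⟨x, hs x x.2⟩
    have ha : LinearIndependent D a := LinearIndependent.of_comp X.val.toLinearMap hi
    exact h.linearIndependent_left ha
  · intro h
    let b := Module.Basis.ofVectorSpace D X
    refine IntermediateField.LinearDisjoint.of_basis_left b ?_
    have hinj : Function.Injective (X.val ∘ b) := Subtype.val_injective.comp b.injective
    rw [← linearIndepOn_id_range_iff hinj, linearIndepOn_iff_linearIndepOn_finset]
    intro t ht
    refine h t (fun x hx => ?_) (LinearIndepOn.mono ?_ ht)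
    · obtain ⟨i, rfl⟩ := ht hx
      exact (b i).2
    · rw [linearIndepOn_id_range_iff hinj]
      exact b.linearIndependent.map' X.val.toLinearMap (LinearMap.ker_eq_bot.2 Subtype.val_injective)

/-- Linear disjointness of `A` and `B`, tested on finite subsets of `A`. -/
theorem linearDisjointOverInf_iff_left :
    LinearDisjointOverInf A B ↔
      ∀ s : Finset K, (∀ x ∈ s, x ∈ A) → LinearIndepOn ↥(A ⊓ B) id (s : Set K) →
        LinearIndepOn B id (s : Set K) :=
  linearDisjoint_iff_forall_finset _ _

/-- Linear disjointness of `A` and `B`, tested on finite subsets of `B`. -/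
theorem linearDisjointOverInf_iff_right :
    LinearDisjointOverInf A B ↔
      ∀ s : Finset K, (∀ x ∈ s, x ∈ B) → LinearIndepOn ↥(A ⊓ B) id (s : Set K) →
        LinearIndepOn A id (s : Set K) :=
  IntermediateField.linearDisjoint_comm.trans (linearDisjoint_iff_forall_finset _ _)

theorem linearDisjointOverInf_of_le (h : A ≤ B) : LinearDisjointOverInf A B := by
  rw [linearDisjointOverInf_iff_right, inf_eq_left.2 h]
  exact fun s _ hi => hi

theorem linearDisjointOverInf_of_ge (h : B ≤ A) : LinearDisjointOverInf A B := by
  rw [linearDisjointOverInf_iff_left, inf_eq_right.2 h]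
  exact fun s _ hi => hi

theorem not_linearIndepOn_subfield_iff {s : Finset K} :
    ¬ LinearIndepOn A id (s : Set K) ↔
      ∃ f : K → K, (∀ x, f x ∈ A) ∧ ∑ x ∈ s, f x * x = 0 ∧ ∃ x ∈ s, f x ≠ 0 := by
  rw [not_linearIndepOn_finset_iff]
  constructor
  · rintro ⟨f, hf, x, hx, hfx⟩
    exact ⟨fun x => f x, fun x => (f x).2, hf, x, hx, fun h => hfx (Subtype.ext h)⟩
  · rintro ⟨f, hfA, hf, x, hx, hfx⟩
    exact ⟨fun x => ⟨f x, hfA x⟩, hf, x, hx, fun h => hfx (congrArg Subtype.val h)⟩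

/-- A field that is linearly disjoint from every member of a family of fields is linearly disjoint
from their intersection: a normalised relation of minimal length with coefficients in `A` is
unique, hence has its coefficients in all members of the family. -/
theorem linearDisjointOverInf_sInf {T : Set (Subfield K)}
    (hT : ∀ B ∈ T, LinearDisjointOverInf A B) : LinearDisjointOverInf A (sInf T) := by
  classical
  rw [linearDisjointOverInf_iff_right]
  intro s
  induction s using Finset.strongInduction with
  | H s ih =>
    intro hs
    contrapose
    intro hdep
    -- A dependent proper subset is dealt with by induction, so the relation may be taken minimal.
    by_cases hmin : ∃ t, t ⊂ s ∧ ¬ LinearIndepOn A id (t : Set K)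
    · obtain ⟨t, hts, ht⟩ := hmin
      intro hi
      exact ht (ih t hts (fun x hx => hs x (hts.1 hx))
        (hi.mono (Finset.coe_subset.2 hts.1)))
    push Not at hmin
    rw [not_linearIndepOn_subfield_iff] at hdep ⊢
    obtain ⟨f, hfA, hf, x₀, hx₀, hfx₀⟩ := hdep
    -- Any relation with coefficients in `A` vanishing at `x₀` is trivial on `s`.
    have key : ∀ g : K → K, (∀ x, g x ∈ A) → ∑ x ∈ s, g x * x = 0 → g x₀ = 0 →
        ∀ x ∈ s, g x = 0 := by
      intro g hgA hg hg0 x hx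
      by_contra hgx
      refine not_linearIndepOn_subfield_iff.2 ⟨g, hgA, ?_, x, ?_, hgx⟩
        (hmin (s.erase x₀) (Finset.erase_ssubset hx₀))
      · rw [← hg, ← Finset.add_sum_erase s _ hx₀, hg0, zero_mul, zero_add]
      · exact Finset.mem_erase.2 ⟨fun h => hgx (h ▸ hg0), hx⟩
    have hmem : ∀ x ∈ s, f x / f x₀ ∈ A ⊓ sInf T := by
      intro x hx
      refine Subfield.mem_inf.2 ⟨div_mem (hfA x) (hfA x₀), Subfield.mem_sInf.2 fun B hB => ?_⟩
      have hBdep : ¬ LinearIndepOn ↥(A ⊓ B) id (s : Set K) := fun hi =>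
        not_linearIndepOn_subfield_iff.2 ⟨f, hfA, hf, x₀, hx₀, hfx₀⟩
          (linearDisjointOverInf_iff_right.1 (hT B hB) s
            (fun y hy => Subfield.mem_sInf.1 (hs y hy) B hB) hi)
      obtain ⟨c, hcAB, hc, x₁, hx₁, hcx₁⟩ := not_linearIndepOn_subfield_iff.1 hBdep
      have hc0 : c x₀ ≠ 0 := fun h => hcx₁ (key c (fun y => (hcAB y).1) hc h x₁ hx₁)
      have h0 := key (fun y => c x₀ * f y - f x₀ * c y)
        (fun y => sub_mem (mul_mem (hcAB x₀).1 (hfA y)) (mul_mem (hfA x₀) (hcAB y).1))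
        (by simp only [sub_mul, mul_assoc, Finset.sum_sub_distrib, ← Finset.mul_sum, hf, hc,
          mul_zero, sub_zero])
        (by ring) x hx
      -- The relations `f` and `c` over `A` are proportional.
      have : f x / f x₀ = c x / c x₀ := by
        rw [div_eq_div_iff hfx₀ hc0]
        linear_combination h0
      rw [this]
      exact div_mem (hcAB x).2 (hcAB x₀).2
    refine ⟨fun x => if x ∈ s then f x / f x₀ else 0, fun x => ?_, ?_, x₀, hx₀, by simp [hx₀, hfx₀]⟩
    · dsimp only
      split_ifs with h
      exacts [hmem x h, zero_mem _]
    · rw [Finset.sum_congr rfl (g := fun x => (f x₀)⁻¹ * (f x * x)) fun x hx => by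
        simp only [if_pos hx]; ring, ← Finset.mul_sum, hf, mul_zero]

/-- If `B ⊔ A` has the same degree over `B` as `A` has over `D`, families in `A` that are linearly
independent over `D` remain so over `B`. -/
theorem linearIndepOn_of_relfinrank_le (hDA : D ≤ A) (hDB : D ≤ B) (h0 : D.relfinrank A ≠ 0)
    (hle : D.relfinrank A ≤ B.relfinrank (B ⊔ A)) {s : Set K} (hs : ∀ x ∈ s, x ∈ A)
    (hi : LinearIndepOn D id s) : LinearIndepOn B id s := by
  have := finiteDimensional_extendScalars hDA h0
  let _ : Algebra D B := (Subfield.inclusion hDB).toAlgebra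
  have : IsScalarTower D B K := IsScalarTower.of_algebraMap_eq fun _ => rfl
  let X := Subfield.extendScalars hDA
  let b := Module.finBasis D X
  have hspan : Submodule.span B (Set.range (X.val ∘ b))
      = Subalgebra.toSubmodule (Subfield.extendScalars (le_sup_left : B ≤ B ⊔ A)).toSubalgebra := by
    have h1 := Subalgebra.adjoin_eq_span_basis B X.toSubalgebra b
    refine h1.symm.trans (congrArg _ ?_)
    change Algebra.adjoin B (X : Set K) = _
    rw [← IntermediateField.adjoin_intermediateField_toSubalgebra_of_isAlgebraic_right B X]
    have h2 := adjoin_eq_extendScalars B (A : Set K)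
    simp only [Subfield.closure_eq] at h2
    exact congrArg _ h2
  have hX' : X.LinearDisjoint B := by
    refine IntermediateField.LinearDisjoint.of_basis_left b ?_
    rw [linearIndependent_iff_card_le_finrank_span, Set.finrank, hspan, Fintype.card_fin,
      ← Subfield.relfinrank_eq_finrank_of_le hDA]
    exact hle.trans_eq (Subfield.relfinrank_eq_finrank_of_le le_sup_left)
  let a : s → X := fun x => ⟨x, hs x x.2⟩
  have ha : LinearIndependent D a := LinearIndependent.of_comp X.val.toLinearMap hi
  exact hX'.linearIndependent_left ha

end LinearDisjointness

/-! ### Towers and the core of an extension -/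

section Towers

variable {K : Type v} [Field K] {p : ℕ} [Fact p.Prime] [CharP K p]
variable {A B D E k F R : Subfield K}

theorem linearIndepOn_of_le (h : D ≤ E) {s : Finset K} (hs : LinearIndepOn E id (s : Set K)) :
    LinearIndepOn D id (s : Set K) := by
  by_contra hd
  obtain ⟨f, hfD, hf⟩ := not_linearIndepOn_subfield_iff.1 hd
  exact not_linearIndepOn_subfield_iff.2 ⟨f, fun x => h (hfD x), hf⟩ hs

theorem relfinrank_tower {F : ℕ → Subfield K} (hF : Monotone F) (i n : ℕ) :
    (F i).relfinrank (F (i + n)) = ∏ l ∈ Finset.range n, (F (i + l)).relfinrank (F (i + l + 1)) := by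
  induction n with
  | zero => simp
  | succ n ih =>
    rw [Finset.prod_range_succ, ← ih, ← add_assoc,
      Subfield.relfinrank_mul_relfinrank (hF (by omega)) (hF (by omega))]

theorem relfinrank_pw_tower (A R : Subfield K) (n : ℕ) :
    (A ⊔ pw p n R).relfinrank (A ⊔ R)
      = ∏ l ∈ Finset.range n, (A ⊔ pw p (l + 1) R).relfinrank (A ⊔ pw p l R) := by
  induction n with
  | zero => simp [pw_zero]
  | succ n ih =>
    rw [Finset.prod_range_succ, ← ih, mul_comm, Subfield.relfinrank_mul_relfinrank
      (sup_pw_antitone n.le_succ) (sup_le_sup_left pw_le A)]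

/-- If `K` is the union of a tower over `F 0` all of whose steps have the same degree and are
related by `F 0 (F (i + 1) ^ p) = F i`, then `K / F 0` is modular. -/
theorem linearDisjointOverInf_of_tower {F : ℕ → Subfield K} (hF : Monotone F)
    (hstep : ∀ i, F 0 ⊔ pw p 1 (F (i + 1)) = F i) {c : ℕ} (hc : c ≠ 0)
    (hdeg : ∀ i, (F i).relfinrank (F (i + 1)) = c) (htop : ∀ x, ∃ i, x ∈ F i) (j : ℕ) :
    LinearDisjointOverInf (pw p j ⊤) (F 0) := by
  have hdeg' : ∀ i n, (F i).relfinrank (F (i + n)) = c ^ n := by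
    intro i n
    rw [relfinrank_tower hF, Finset.prod_congr rfl fun l _ => hdeg (i + l)]
    simp
  have hstep' : ∀ j n, F 0 ⊔ pw p j (F (n + j)) = F n := by
    intro j n
    induction j with
    | zero => rw [pw_zero]; exact sup_eq_right.2 (hF n.zero_le)
    | succ j ih => rw [← ih, ← hstep (n + j), sup_pw_sup le_rfl, pw_pw, add_comm 1 j, add_assoc]
  have hle : pw p j (F j) ≤ F 0 := by
    have := hstep' j 0
    rw [zero_add] at this
    exact sup_eq_left.1 this
  rw [linearDisjointOverInf_iff_left]
  intro s hs hi
  choose! y _ hyx using hs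
  choose f hf using htop
  obtain ⟨n, hn⟩ : ∃ n, ∀ x ∈ s, x ∈ pw p j (F (n + j)) := by
    refine ⟨s.sup (f ∘ y), fun x hx => ⟨y x, hF ?_ (hf (y x)), hyx x hx⟩⟩
    exact (Finset.le_sup (f := f ∘ y) hx).trans (Nat.le_add_right _ _)
  have hd : (pw p j (F j)).relfinrank (pw p j (F (n + j))) = c ^ n := by
    rw [relfinrank_pw, add_comm, hdeg']
  refine linearIndepOn_of_relfinrank_le (pw_mono (hF (Nat.le_add_left j n))) hle
    (by rw [hd]; exact pow_ne_zero _ hc) ?_ hn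
    (linearIndepOn_of_le (le_inf (pw_mono le_top) hle) hi)
  rw [hd, hstep', ← hdeg' 0 n, zero_add]

/-- A decreasing sequence of subfields inside a finite extension of `k` stabilises. -/
theorem exists_eq_iInf {B : ℕ → Subfield K} (hB : Antitone B) (hk : ∀ n, k ≤ B n)
    (h0 : k.relfinrank (B 0) ≠ 0) : ∃ N, ∀ n, N ≤ n → B n = ⨅ m, B m := by
  let N := Function.argmin (fun n => k.relfinrank (B n))
  have h : ∀ n, B N ≤ B n := by
    intro n
    have hle : B (max N n) ≤ B N := hB (le_max_left _ _)
    have := eq_of_relfinrank_le (hk _) hle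
      (relfinrank_left_ne_zero (hk _) (hB (Nat.zero_le N)) h0)
      (Function.argmin_le (fun n => k.relfinrank (B n)) _)
    rw [← this]
    exact hB (le_max_right _ _)
  exact ⟨N, fun n hn => le_antisymm ((hB hn).trans (le_iInf h)) (iInf_le _ _)⟩

variable (p) in
/-- The field `k(k_{n+i} ^ (p ^ n))`, where `k_m` denotes `k ^ (p ^ (-m)) ∩ K`. -/
def layer (k : Subfield K) (i n : ℕ) : Subfield K :=
  k ⊔ pw p n (rt p (n + i) k)

variable (p) in
/-- The intersection over `n` of the fields `k(k_{n+i} ^ (p ^ n))`. -/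
def core (k : Subfield K) (i : ℕ) : Subfield K :=
  ⨅ n, layer p k i n

theorem pw_rt_le (m n : ℕ) : pw p m (rt p (m + n) k) ≤ rt p n k := by
  rw [pw_le_iff]
  intro x hx
  rw [mem_rt, mem_rt, ← pow_mul, ← pow_add]
  exact hx

theorem layer_antitone (i : ℕ) : Antitone (layer p k i) := by
  refine antitone_nat_of_succ_le fun n => ?_
  unfold layer
  rw [add_comm n 1, ← pw_pw, add_assoc]
  exact sup_le_sup_left (pw_mono (pw_rt_le 1 (n + i))) k

theorem layer_mono (n : ℕ) : Monotone fun i => layer p k i n :=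
  fun _ _ h => sup_le_sup_left (pw_mono (rt_mono (Nat.add_le_add_left h n))) k

theorem sup_pw_layer (i n : ℕ) : k ⊔ pw p 1 (layer p k (i + 1) n) = layer p k i (n + 1) := by
  unfold layer
  rw [sup_pw_sup le_rfl, pw_pw, add_right_comm n 1 i, add_assoc]

theorem layer_zero_right (i : ℕ) : layer p k i 0 = rt p i k := by
  unfold layer
  rw [pw_zero, zero_add, sup_eq_right.2 le_rt]

theorem layer_zero_left (n : ℕ) : layer p k 0 n = k :=
  sup_eq_left.2 (pw_le_iff.2 le_rfl)

theorem core_zero : core p k 0 = k := by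
  simp [core, layer_zero_left]

theorem le_core (i : ℕ) : k ≤ core p k i :=
  le_iInf fun _ => le_sup_left

theorem core_mono : Monotone (core p k) :=
  fun _ _ h => iInf_mono fun n => layer_mono n h

theorem core_le_rt (i : ℕ) : core p k i ≤ rt p i k :=
  (iInf_le _ 0).trans_eq (layer_zero_right i)

section Bounded

variable {N : ℕ} (hN : RDegBounded p k N)
include hN

/-- The layers decrease inside the finite extension `k_i / k`, hence stabilise. -/
theorem exists_layer_eq_core (i : ℕ) : ∃ m, ∀ n, m ≤ n → layer p k i n = core p k i :=
  exists_eq_iInf (layer_antitone i) (fun _ => le_sup_left)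
    (by rw [layer_zero_right]; exact hN.relfinrank_rt_ne_zero i)

theorem sup_pw_core (i : ℕ) : k ⊔ pw p 1 (core p k (i + 1)) = core p k i := by
  obtain ⟨m₁, h₁⟩ := exists_layer_eq_core hN i
  obtain ⟨m₂, h₂⟩ := exists_layer_eq_core hN (i + 1)
  rw [← h₂ (max m₁ m₂) (le_max_right _ _), sup_pw_layer,
    h₁ _ ((le_max_left m₁ m₂).trans (Nat.le_succ _))]

theorem relfinrank_core_ne_zero (i : ℕ) : k.relfinrank (core p k i) ≠ 0 :=
  relfinrank_left_ne_zero (le_core i) (core_le_rt i) (hN.relfinrank_rt_ne_zero i)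

theorem relfinrank_core_succ (i : ℕ) :
    (core p k i).relfinrank (core p k (i + 1)) = rdeg p k (core p k (i + 1)) := by
  rw [rdeg, sup_pw_core hN]

theorem relfinrank_core_succ_pos (i : ℕ) :
    0 < (core p k i).relfinrank (core p k (i + 1)) :=
  Nat.pos_of_ne_zero (relfinrank_right_ne_zero (le_core i) (core_mono i.le_succ)
    (relfinrank_core_ne_zero hN _))

theorem relfinrank_core_succ_mono :
    Monotone fun i => (core p k i).relfinrank (core p k (i + 1)) := by
  refine monotone_nat_of_le_succ fun i => ?_
  rw [relfinrank_core_succ hN, relfinrank_core_succ hN]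
  exact rdeg_mono (le_core _) (core_mono (Nat.le_succ _)) (relfinrank_core_ne_zero hN _)

/-- The degrees of the steps of the core are increasing and bounded, hence eventually constant. -/
theorem exists_relfinrank_core_eq : ∃ i₀,
    (∀ i, (core p k i).relfinrank (core p k (i + 1))
      ≤ (core p k i₀).relfinrank (core p k (i₀ + 1))) ∧
    ∀ i, i₀ ≤ i → (core p k i).relfinrank (core p k (i + 1))
      = (core p k i₀).relfinrank (core p k (i₀ + 1)) := by
  set C : ℕ → ℕ := fun i => (core p k i).relfinrank (core p k (i + 1)) with hC
  have hCN : ∀ i, C i ≤ N := fun i => (relfinrank_core_succ hN i).trans_le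
    (hN _ (le_core _) (relfinrank_core_ne_zero hN _))
  have hmax : ∀ i, C i ≤ C (Function.argmin fun i => N - C i) := fun i => by
    have h1 := Function.argmin_le (fun i => N - C i) i
    have h2 := hCN i
    have h3 := hCN (Function.argmin fun i => N - C i)
    omega
  exact ⟨_, hmax, fun i hi => le_antisymm (hmax i) (relfinrank_core_succ_mono hN hi)⟩

end Bounded

/-- If `K / k` is relatively perfect and `k ≠ K`, the first layer of the core is not `k`. -/
theorem two_le_relfinrank_core {N : ℕ} (hN : RDegBounded p k N) (hpi : IsPI p k)
    (hperf : k ⊔ pw p 1 ⊤ = ⊤) (hk : k ≠ ⊤) :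
    2 ≤ (core p k 0).relfinrank (core p k 1) := by
  have h0 := relfinrank_core_succ_pos hN 0
  rw [zero_add] at h0
  suffices (core p k 0).relfinrank (core p k 1) ≠ 1 by omega
  rw [Ne, Subfield.relfinrank_eq_one_iff, core_zero]
  intro hle
  -- Otherwise `k_{n+1} = k_n` for some `n`, so `K = k_n` has bounded exponent.
  obtain ⟨n, hn⟩ := exists_layer_eq_core hN 1
  have h1 : rt p (n + 1) k ≤ rt p n k := by
    rw [← pw_le_iff]
    exact le_sup_right.trans ((hn n le_rfl).trans_le hle)
  have h2 : ∀ m, rt p (n + m) k ≤ rt p n k := by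
    intro m
    induction m with
    | zero => exact le_rfl
    | succ m ih =>
      intro x hx
      refine ih (?_ : x ∈ rt p (n + m) k)
      have : x ^ p ^ m ∈ rt p (n + 1) k := by
        rw [mem_rt, ← pow_mul, ← pow_add]
        rwa [mem_rt, show n + (m + 1) = m + (n + 1) by omega] at hx
      have := h1 this
      rwa [mem_rt, ← pow_mul, ← pow_add, add_comm] at this
  refine hk (eq_top_of_pw_le (p := p) (n := n) hperf (pw_le_iff.2 fun x _ => ?_))
  obtain ⟨m, hm⟩ := hpi x
  exact h2 m (rt_mono (Nat.le_add_left m n) hm)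

/-- In a relatively perfect extension, every finite subextension of `K / k` lies in some
`k(k_n ^ (p ^ j))`. -/
theorem exists_le_sup_pw_rt (hpi : IsPI p k) (hperf : k ⊔ pw p 1 ⊤ = ⊤) (hkD : k ≤ D)
    (hD : k.relfinrank D ≠ 0) (j : ℕ) : ∃ n, j ≤ n ∧ D ≤ k ⊔ pw p j (rt p n k) := by
  have hmono : Monotone fun n => k ⊔ pw p j (rt p n k) :=
    fun _ _ h => sup_le_sup_left (pw_mono (rt_mono h)) k
  have hU : ∀ x, ∃ n, x ∈ k ⊔ pw p j (rt p n k) := by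
    intro x
    rw [← Subfield.mem_iSup_of_directed hmono.directed_le]
    suffices k ⊔ pw p j ⊤ ≤ ⨆ n, k ⊔ pw p j (rt p n k) by
      rw [sup_pw_top_eq_top hperf] at this
      exact this trivial
    refine sup_le (le_iSup_of_le 0 le_sup_left) ?_
    rintro _ ⟨y, -, rfl⟩
    obtain ⟨n, hn⟩ := hpi y
    exact le_iSup (fun n => k ⊔ pw p j (rt p n k)) n
      ((le_sup_right : pw p j (rt p n k) ≤ k ⊔ _) ⟨y, hn, rfl⟩)
  obtain ⟨S, rfl⟩ := exists_finset_sup_closure hkD hD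
  choose f hf using hU
  refine ⟨max j (S.sup f), le_max_left _ _, sup_le le_sup_left ?_⟩
  rw [Subfield.closure_le]
  exact fun x hx => hmono ((Finset.le_sup hx).trans (le_max_right _ _)) (hf x)

end Towers

/-! ### Modularity over a proper intermediate field -/

section Existence

variable {K : Type v} [Field K] {p : ℕ} [Fact p.Prime] [CharP K p]
variable {E k R : Subfield K} {N : ℕ}

variable (p) in
/-- The union of the core layers. -/
def coreUnion (k : Subfield K) : Subfield K :=
  ⨆ i, core p k i

theorem mem_coreUnion {x : K} : x ∈ coreUnion p k ↔ ∃ i, x ∈ core p k i :=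
  Subfield.mem_iSup_of_directed core_mono.directed_le

theorem core_le_coreUnion (i : ℕ) : core p k i ≤ coreUnion p k :=
  le_iSup _ i

theorem le_coreUnion : k ≤ coreUnion p k :=
  (le_core 0).trans (core_le_coreUnion 0)

theorem core_ne_top (hperf : k ⊔ pw p 1 ⊤ = ⊤) (hk : k ≠ ⊤) (i : ℕ) : core p k i ≠ ⊤ := fun h =>
  hk (eq_top_of_pw_le (p := p) (n := i) hperf (pw_le_iff.2 (h.symm.le.trans (core_le_rt i))))

/-- If the core exhausts `K`, then `K` is modular over all large enough layers of the core. -/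
theorem exists_modular_of_coreUnion_eq_top (hN : RDegBounded p k N)
    (h : coreUnion p k = ⊤) :
    ∃ i, ∀ j, LinearDisjointOverInf (pw p j ⊤) (core p k i) := by
  obtain ⟨i₀, -, hi₀⟩ := exists_relfinrank_core_eq hN
  refine ⟨i₀, fun j => linearDisjointOverInf_of_tower (F := fun i => core p k (i₀ + i))
    (fun _ _ h => core_mono (Nat.add_le_add_left h i₀)) (fun i => ?_)
    (relfinrank_core_succ_pos hN i₀).ne' (fun i => hi₀ _ (Nat.le_add_right _ _)) (fun x => ?_) j⟩
  · rw [← sup_eq_left.2 (le_core (p := p) (k := k) (i₀ + 0)), sup_assoc, ← add_assoc,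
      sup_pw_core hN]
    exact sup_eq_right.2 (core_mono (Nat.le_add_right _ _))
  · obtain ⟨i, hi⟩ := mem_coreUnion.1 ((h ▸ trivial : x ∈ coreUnion p k))
    exact ⟨i, core_mono (Nat.le_add_left _ _) hi⟩

/-- Adjoining a layer `F_{m+1}` of the core lowers `[E : k(E ^ p)]` at most by the factor
`[F_{m+1} : F_m]`, as `k(F_{m+1} ^ p) = F_m`. -/
theorem rdeg_le_mul_relfinrank_core (hN : RDegBounded p k N) (hkE : k ≤ E)
    (hE : k.relfinrank E ≠ 0) (m : ℕ) :
    rdeg p k E ≤ (core p k (m + 1) ⊔ pw p 1 E).relfinrank (core p k (m + 1) ⊔ E)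
      * (core p k m).relfinrank (core p k (m + 1)) := by
  have h0 := relfinrank_core_ne_zero hN (m + 1)
  have h1 := rdeg_mono (p := p) hkE (le_sup_right : E ≤ core p k (m + 1) ⊔ E)
    (relfinrank_sup_ne_zero (le_core _) hkE h0 hE)
  have h2 : rdeg p k (core p k (m + 1) ⊔ E)
      = (core p k m ⊔ pw p 1 E).relfinrank (core p k (m + 1) ⊔ E) := by
    rw [rdeg, pw_sup, ← sup_assoc, sup_pw_core hN]
  have h3 := (relfinrank_sup_le (core_mono m.le_succ)
    (relfinrank_right_ne_zero (le_core m) (core_mono m.le_succ) h0) (pw p 1 E)).2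
  rw [h2, ← Subfield.relfinrank_mul_relfinrank
    (sup_le_sup_right (core_mono m.le_succ) (pw p 1 E)) (sup_le_sup_left pw_le _), mul_comm] at h1
  exact h1.trans (Nat.mul_le_mul_left _ h3)

theorem prod_range_ite (c : ℕ) {j n : ℕ} (h : j ≤ n) :
    ∏ i ∈ Finset.range n, (if i < j then c else 1) = c ^ j := by
  obtain ⟨d, rfl⟩ := Nat.exists_eq_add_of_le h
  rw [Finset.prod_range_add, Finset.prod_congr rfl fun i hi => if_pos (Finset.mem_range.1 hi)]
  simp

/-- Passing from `k` to the union of the core layers lowers the bound for `[E : k(E ^ p)]`. -/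
theorem rdeg_lt_of_coreUnion_le (hN : RDegBounded p k N) (hpi : IsPI p k)
    (hperf : k ⊔ pw p 1 ⊤ = ⊤) (hk : k ≠ ⊤) (hE : coreUnion p k ≤ E)
    (hE0 : (coreUnion p k).relfinrank E ≠ 0) : rdeg p (coreUnion p k) E < N := by
  by_contra! hlt
  set F := coreUnion p k with hF
  obtain ⟨i₀, hmax, hconst⟩ := exists_relfinrank_core_eq hN
  set C : ℕ → ℕ := fun i => (core p k i).relfinrank (core p k (i + 1)) with hC
  obtain ⟨D, hkD, hD0, rfl⟩ := hpi.exists_eq_sup le_coreUnion hE hE0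
  obtain ⟨n, hjn, hDn⟩ := exists_le_sup_pw_rt hpi hperf hkD hD0 (i₀ + 1)
  obtain ⟨m, rfl⟩ : ∃ m, n = m + 1 := ⟨n - 1, by omega⟩
  set n := m + 1 with hn
  set R := rt p n k with hR
  have hR0 : k.relfinrank R ≠ 0 := hN.relfinrank_rt_ne_zero n
  set Φ := core p k n with hΦ
  -- `a` and `b` are the degrees of the steps in the chains `k(k_n ^ (p ^ i))` and
  -- `F_n(k_n ^ (p ^ i))`, where `F_n` is `Φ`.
  let a : ℕ → ℕ := fun i => (k ⊔ pw p (i + 1) R).relfinrank (k ⊔ pw p i R)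
  let b : ℕ → ℕ := fun i => (Φ ⊔ pw p (i + 1) R).relfinrank (Φ ⊔ pw p i R)
  have hfin : ∀ i, k.relfinrank (k ⊔ pw p i R) ≠ 0 := fun i =>
    relfinrank_left_ne_zero le_sup_left (sup_le le_rt pw_le) hR0
  have haN : ∀ i, a i ≤ N := fun i => rdeg_sup_pw.symm.trans_le (hN _ le_sup_left (hfin i))
  have hab : ∀ i, a i ≤ b i * C i₀ := by
    intro i
    have h1 := rdeg_le_mul_relfinrank_core hN (le_sup_left : k ≤ k ⊔ pw p i R) (hfin i) m
    rw [rdeg_sup_pw, sup_pw_sup (le_core _), pw_pw, ← sup_assoc,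
      sup_eq_left.2 (le_core (m + 1))] at h1
    exact h1.trans (Nat.mul_le_mul_left _ (hmax m))
  -- The first steps over `F_n` are at least those over the union `F`, whose degree is at least `N`
  -- because they bound `[F(D) : F(D ^ p)]`.
  have hbN : ∀ i, i < i₀ + 1 → N ≤ b i := by
    intro i hi
    have hkF : k ≤ F := le_coreUnion
    have h1 : F ⊔ D ≤ F ⊔ pw p i R :=
      sup_le le_sup_left (hDn.trans (sup_le (hkF.trans le_sup_left)
        ((pw_antitone hi.le).trans le_sup_right)))
    have h2 := (relfinrank_sup_le le_sup_left (hfin i) F).1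
    rw [sup_eq_right.2 hkF, sup_right_comm, sup_eq_right.2 hkF] at h2
    have h3 := rdeg_mono (p := p) hE h1 h2
    rw [rdeg_sup_pw] at h3
    have hΦF : Φ ≤ F := core_le_coreUnion n
    have hΦ0 : (Φ ⊔ pw p (i + 1) R).relfinrank (Φ ⊔ pw p i R) ≠ 0 := by
      have h5 : k.relfinrank (Φ ⊔ pw p i R) ≠ 0 :=
        relfinrank_left_ne_zero ((le_core n).trans le_sup_left)
          (sup_le (core_le_rt n) pw_le) hR0
      exact relfinrank_right_ne_zero ((le_core n).trans le_sup_left)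
        (sup_pw_antitone i.le_succ) h5
    have h4 := (relfinrank_sup_le (sup_pw_antitone i.le_succ) hΦ0 F).2
    rw [sup_right_comm, sup_right_comm _ _ F, sup_eq_right.2 hΦF] at h4
    exact hlt.trans (h3.trans h4)
  -- Both sides are `[k_n : k]`; the right factor on the left is `[k_n : F_n]`.
  have hprod : ((∏ i ∈ Finset.range n, C i) * ∏ i ∈ Finset.range n, b i)
      = ∏ i ∈ Finset.range n, a i := by
    rw [← relfinrank_pw_tower, ← relfinrank_pw_tower, sup_eq_left.2 (pw_le_iff.2 le_rfl),
      sup_eq_left.2 ((pw_le_iff.2 le_rfl : pw p n R ≤ k).trans (le_core n)), sup_eq_right.2 le_rt,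
      sup_eq_right.2 (core_le_rt n), ← Subfield.relfinrank_mul_relfinrank (le_core n) (core_le_rt n)]
    congr 1
    have := relfinrank_tower (core_mono (p := p) (k := k)) 0 n
    simp only [zero_add, core_zero] at this
    exact this.symm
  -- For the first `i₀ + 1` indices one even has `a i ≤ b i`.
  have hlow : (∏ i ∈ Finset.range n, a i) * C i₀ ^ (i₀ + 1)
      ≤ (∏ i ∈ Finset.range n, b i) * C i₀ ^ n := by
    rw [← prod_range_ite (C i₀) hjn, ← Finset.prod_mul_distrib]
    calc _ ≤ ∏ i ∈ Finset.range n, b i * C i₀ := by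
          refine Finset.prod_le_prod' fun i _ => ?_
          split_ifs with h
          · exact Nat.mul_le_mul_right _ ((haN i).trans (hbN i h))
          · rw [mul_one]; exact hab i
      _ = _ := by rw [Finset.prod_mul_distrib]; simp
  have hup : C i₀ ^ n ≤ (∏ i ∈ Finset.range n, C i) * C i₀ ^ i₀ := by
    rw [← prod_range_ite (C i₀) ((Nat.le_succ i₀).trans hjn), ← Finset.prod_mul_distrib]
    calc C i₀ ^ n = ∏ i ∈ Finset.range n, C i₀ := by simp
      _ ≤ _ := by
          refine Finset.prod_le_prod' fun i _ => ?_
          split_ifs with h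
          · exact Nat.le_mul_of_pos_left _ (relfinrank_core_succ_pos hN i)
          · rw [mul_one]; exact (hconst i (not_lt.1 h)).ge
  have hC2 : 2 ≤ C i₀ := (two_le_relfinrank_core hN hpi hperf hk).trans (hmax 0)
  have hCpos : 0 < ∏ i ∈ Finset.range n, C i :=
    Finset.prod_pos fun i _ => relfinrank_core_succ_pos hN i
  have hapos : 0 < ∏ i ∈ Finset.range n, a i := Finset.prod_pos fun i _ =>
    Nat.pos_of_ne_zero (relfinrank_right_ne_zero le_sup_left (sup_pw_antitone i.le_succ) (hfin i))
  have hbpos : 0 < ∏ i ∈ Finset.range n, b i := by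
    rw [← hprod] at hapos
    exact Nat.pos_of_mul_pos_left hapos
  have hfinal : C i₀ ^ (i₀ + 1) ≤ C i₀ ^ i₀ := by
    rw [← hprod] at hlow
    refine Nat.le_of_mul_le_mul_left (c := (∏ i ∈ Finset.range n, C i) * ∏ i ∈ Finset.range n, b i)
      ?_ (Nat.mul_pos hCpos hbpos)
    refine hlow.trans ((Nat.mul_le_mul_left _ hup).trans_eq ?_)
    ring
  exact absurd hfinal (not_le.2 (Nat.pow_lt_pow_right (by omega) (Nat.lt_succ_self i₀)))

/-- A relatively perfect extension `K ≠ k` with bounded degrees `[E : k(E ^ p)]` is modular over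
some proper intermediate field. -/
theorem exists_modular_of_relPerfect (hN : RDegBounded p k N) (hpi : IsPI p k)
    (hperf : k ⊔ pw p 1 ⊤ = ⊤) (hk : k ≠ ⊤) :
    ∃ L, k ≤ L ∧ L ≠ ⊤ ∧ ∀ j, LinearDisjointOverInf (pw p j ⊤) L := by
  induction N using Nat.strong_induction_on generalizing k with
  | _ N ih =>
    by_cases hF : coreUnion p k = ⊤
    · obtain ⟨i, hi⟩ := exists_modular_of_coreUnion_eq_top hN hF
      exact ⟨_, le_core i, core_ne_top hperf hk i, hi⟩
    · have hlt := fun E hE hE0 => rdeg_lt_of_coreUnion_le (E := E) hN hpi hperf hk hE hE0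
      have hpos : 0 < N := (Nat.zero_le _).trans_lt (hlt _ le_rfl (by simp))
      obtain ⟨L, hL, h⟩ := ih (N - 1) (by omega)
        (fun E hE hE0 => Nat.le_sub_one_of_lt (hlt E hE hE0)) (hpi.mono le_coreUnion)
        (top_le_iff.1 (hperf.symm.le.trans (sup_le_sup_right le_coreUnion _))) hF
      exact ⟨L, le_coreUnion.trans hL, h⟩

end Existence

/-! ### Existence of `r`-bases -/

section RBases

variable {K : Type v} [Field K] {p : ℕ} [Fact p.Prime] [CharP K p]

theorem exists_relfinrank_eq_pow {A B : Subfield K} (hAB : A ≤ B) (h0 : A.relfinrank B ≠ 0)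
    (hp : ∀ x ∈ B, x ^ p ∈ A) : ∃ n, A.relfinrank B = p ^ n := by
  have := finiteDimensional_extendScalars hAB h0
  have : CharP A p := A.subtype.charP A.subtype.injective p
  have : IsPurelyInseparable A (Subfield.extendScalars hAB) :=
    (isPurelyInseparable_iff_pow_mem A p).2 fun x =>
      ⟨1, ⟨x ^ p, hp x x.2⟩, Subtype.ext (by rw [pow_one]; rfl)⟩
  rw [Subfield.relfinrank_eq_finrank_of_le hAB]
  exact IsPurelyInseparable.finrank_eq_pow _ _ p

/-- The exchange property for extensions of exponent one. -/
theorem mem_sup_closure_exchange {T : Subfield K} (hT : ∀ x, x ^ p ∈ T) {x y : K}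
    (hx : x ∈ T ⊔ Subfield.closure {y}) (hxT : x ∉ T) : y ∈ T ⊔ Subfield.closure {x} := by
  have hp : 1 < p := (Fact.out : p.Prime).one_lt
  obtain ⟨hx0, -⟩ := relfinrank_closure_singleton (by omega) (hT x)
  obtain ⟨hy0, hyp⟩ := relfinrank_closure_singleton (by omega) (hT y)
  obtain ⟨n, hn⟩ := exists_relfinrank_eq_pow (p := p) le_sup_left hx0 fun z _ => hT z
  have hn0 : n ≠ 0 := by
    rintro rfl
    rw [pow_zero, Subfield.relfinrank_eq_one_iff] at hn
    exact hxT (hn ((le_sup_right : _ ≤ T ⊔ Subfield.closure {x}) (Subfield.subset_closure rfl)))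
  have hle : T ⊔ Subfield.closure {x} ≤ T ⊔ Subfield.closure {y} := by
    refine sup_le le_sup_left ?_
    rw [Subfield.closure_le]
    simpa using hx
  rw [eq_of_relfinrank_le le_sup_left hle hy0 (hyp.trans (hn ▸ Nat.le_self_pow hn0 p))]
  exact (le_sup_right : _ ≤ T ⊔ Subfield.closure {y}) (Subfield.subset_closure rfl)

/-- By Zorn's lemma there is a maximal independent set; the exchange property shows that it
generates. -/
theorem exists_minimal_generator {T : Subfield K} (hT : ∀ x, x ^ p ∈ T) :
    ∃ B : Set K, T ⊔ Subfield.closure B = ⊤ ∧ ∀ x ∈ B, x ∉ T ⊔ Subfield.closure (B \ {x}) := by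
  obtain ⟨B, hB⟩ := zorn_subset {B : Set K | ∀ x ∈ B, x ∉ T ⊔ Subfield.closure (B \ {x})} <| by
    intro c hc hchain
    refine ⟨⋃₀ c, ?_, fun s hs => Set.subset_sUnion_of_mem hs⟩
    rintro x ⟨B₀, hB₀, hxB₀⟩ hx
    have : Nonempty c := ⟨⟨B₀, hB₀⟩⟩
    have hdir : Directed (· ≤ ·) fun B : c => T ⊔ Subfield.closure ((B : Set K) \ {x}) := by
      rintro ⟨B₁, h₁⟩ ⟨B₂, h₂⟩
      obtain ⟨B, hB, h1, h2⟩ := hchain.directedOn B₁ h₁ B₂ h₂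
      exact ⟨⟨B, hB⟩, sup_le_sup_left (Subfield.closure_mono (Set.sdiff_subset_sdiff_left h1)) T,
        sup_le_sup_left (Subfield.closure_mono (Set.sdiff_subset_sdiff_left h2)) T⟩
    have hle : T ⊔ Subfield.closure (⋃₀ c \ {x})
        ≤ ⨆ B : c, T ⊔ Subfield.closure ((B : Set K) \ {x}) := by
      refine sup_le (le_iSup_of_le ⟨B₀, hB₀⟩ le_sup_left) ?_
      rw [Subfield.closure_le]
      rintro y ⟨⟨B, hB, hy⟩, hyx⟩
      exact le_iSup (fun B : c => T ⊔ Subfield.closure ((B : Set K) \ {x})) ⟨B, hB⟩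
        ((le_sup_right : _ ≤ T ⊔ _) (Subfield.subset_closure ⟨hy, hyx⟩))
    obtain ⟨B, hB⟩ := (Subfield.mem_iSup_of_directed hdir).1 (hle hx)
    obtain ⟨B', hB', h1, h2⟩ := hchain.directedOn B₀ hB₀ B B.2
    exact hc hB' x (h1 hxB₀)
      (sup_le_sup_left (Subfield.closure_mono (Set.sdiff_subset_sdiff_left h2)) T hB)
  refine ⟨B, ?_, hB.prop⟩
  rw [eq_top_iff]
  intro y _
  by_contra hy
  have hyB : y ∉ B := fun h => hy ((le_sup_right : _ ≤ T ⊔ _) (Subfield.subset_closure h))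
  refine hyB (hB.le_of_ge (y := insert y B) ?_ (Set.subset_insert y B) (Set.mem_insert y B))
  rintro x (rfl | hxB) hx
  · refine hy (sup_le_sup_left (Subfield.closure_mono ?_) T hx)
    rintro z ⟨rfl | hz, hzx⟩
    exacts [absurd rfl hzx, hz]
  · have hne : x ≠ y := fun h => hyB (h ▸ hxB)
    have h1 : T ⊔ Subfield.closure (insert y B \ {x})
        = T ⊔ Subfield.closure (B \ {x}) ⊔ Subfield.closure {y} := by
      rw [sup_assoc, ← Subfield.closure_union, Set.union_singleton,
        Set.insert_sdiff_of_notMem _ (by simpa using hne.symm)]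
    have h2 := mem_sup_closure_exchange (p := p)
      (fun z => (le_sup_left : T ≤ T ⊔ Subfield.closure (B \ {x})) (hT z)) (h1 ▸ hx)
      (hB.prop x hxB)
    rw [sup_assoc, ← Subfield.closure_union, Set.sdiff_union_self, Set.union_singleton,
      Set.insert_eq_of_mem hxB] at h2
    exact hy h2

end RBases

/-! ### Bounded degrees in `q`-finite extensions -/

section QFinite

variable {k : Type u} {K : Type v} [Field k] [Field K] [Algebra k K] {p : ℕ} [Fact p.Prime]
  [CharP K p]

theorem adjoinPowers_toSubfield :
    (adjoinPowers k K p).toSubfield = (algebraMap k K).fieldRange ⊔ pw p 1 ⊤ := by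
  apply le_antisymm
  · change Subfield.closure _ ≤ _
    rw [Subfield.closure_le]
    rintro _ (⟨x, rfl⟩ | ⟨x, rfl⟩)
    · exact (le_sup_left : (algebraMap k K).fieldRange ≤ _) ⟨x, rfl⟩
    · exact (le_sup_right : _ ≤ (algebraMap k K).fieldRange ⊔ pw p 1 ⊤)
        (mem_pw.2 ⟨x, trivial, by simp⟩)
  · refine sup_le ?_ ?_
    · rintro _ ⟨x, rfl⟩
      exact (adjoinPowers k K p).algebraMap_mem x
    · rintro _ ⟨x, -, rfl⟩
      exact IntermediateField.subset_adjoin _ _ ⟨x, by simp [frobenius_def]⟩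

theorem isRBase_iff {B : Set K} :
    IsRBase k K p B ↔ (algebraMap k K).fieldRange ⊔ pw p 1 ⊤ ⊔ Subfield.closure B = ⊤ ∧
      ∀ x ∈ B, x ∉ (algebraMap k K).fieldRange ⊔ pw p 1 ⊤ ⊔ Subfield.closure (B \ {x}) := by
  rw [← adjoinPowers_toSubfield]
  have h : ∀ (S : Set K) (x : K), x ∈ IntermediateField.adjoin (adjoinPowers k K p) S ↔
      x ∈ (adjoinPowers k K p).toSubfield ⊔ Subfield.closure S := by
    intro S x
    change x ∈ IntermediateField.adjoin (adjoinPowers k K p).toSubfield S ↔ _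
    rw [adjoin_eq_extendScalars]
    rfl
  unfold IsRBase IsMinimalRGenerator
  simp only [h, IntermediateField.ext_iff, Subfield.ext_iff, IntermediateField.mem_top,
    Subfield.mem_top]

/-- Since `r`-bases exist, the infimum defining `rBaseCard` is attained. -/
theorem exists_isRBase_of_rBaseCard_le {d : ℕ} (h : rBaseCard k K p ≤ d) :
    ∃ B : Finset K, B.card ≤ d ∧ IsRBase k K p (B : Set K) := by
  obtain ⟨B₀, hB₀⟩ := exists_minimal_generator (K := K) (p := p)
    (T := (algebraMap k K).fieldRange ⊔ pw p 1 ⊤)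
    (fun x => (le_sup_right : _ ≤ (algebraMap k K).fieldRange ⊔ pw p 1 ⊤)
      (mem_pw.2 ⟨x, trivial, by simp⟩))
  obtain ⟨B, hB, hcard⟩ := csInf_mem (s := {c | ∃ B : Set K, IsRBase k K p B ∧ Cardinal.mk B = c})
    ⟨_, B₀, isRBase_iff.2 hB₀, rfl⟩
  have hle : Cardinal.mk B ≤ d := hcard.trans_le h
  have hfin : B.Finite := Cardinal.lt_aleph0_iff_set_finite.1 (hle.trans_lt Cardinal.natCast_lt_aleph0)
  lift B to Finset K using hfin
  refine ⟨B, ?_, hB⟩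
  change Cardinal.mk ↥B ≤ d at hle
  rw [Cardinal.mk_coe_finset] at hle
  exact_mod_cast hle

/-- An extension of bounded exponent is generated by any of its `r`-bases, so it is finite if it has a
finite `r`-base. -/
theorem relfinrank_of_isRBase {n : ℕ} {B : Finset K} (hB : IsRBase k K p (B : Set K))
    (hn : ∀ x : K, x ^ p ^ n ∈ (algebraMap k K).fieldRange) :
    (algebraMap k K).fieldRange.relfinrank ⊤ ≠ 0 ∧
      rdeg p (algebraMap k K).fieldRange ⊤ ≤ p ^ B.card := by
  have hgen := (isRBase_iff.1 hB).1
  constructor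
  · have h1 : (algebraMap k K).fieldRange ⊔ Subfield.closure (B : Set K) = ⊤ := by
      refine eq_top_of_pw_le (p := p) (n := n) (by rw [sup_right_comm]; exact hgen) ?_
      rintro _ ⟨x, -, rfl⟩
      exact (le_sup_left : (algebraMap k K).fieldRange ≤ _) (hn x)
    rw [← h1]
    exact (relfinrank_closure_finset p_pow_pos B fun x _ => hn x).1
  · have h2 := (relfinrank_closure_finset (k := (algebraMap k K).fieldRange ⊔ pw p 1 ⊤)
      (Fact.out : p.Prime).pos B fun x _ =>
        (le_sup_right : _ ≤ (algebraMap k K).fieldRange ⊔ pw p 1 ⊤)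
          (mem_pw.2 ⟨x, trivial, by simp⟩)).2
    rwa [hgen] at h2

theorem map_pw {L : Type*} [Field L] [CharP L p] (f : K →+* L) (n : ℕ) (A : Subfield K) :
    (pw p n A).map f = pw p n (A.map f) := by
  ext x
  simp [mem_pw, Subfield.mem_map]

theorem rdeg_map {L : Type*} [Field L] [CharP L p] (f : K →+* L) (A B : Subfield K) :
    rdeg p (A.map f) (B.map f) = rdeg p A B := by
  rw [rdeg, ← map_pw, ← Subfield.map_sup, Subfield.relfinrank_map_map, rdeg]

theorem IsPI.exists_le_rt {k E : Subfield K} (h : IsPI p k) (hkE : k ≤ E)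
    (h0 : k.relfinrank E ≠ 0) : ∃ n, E ≤ rt p n k := by
  obtain ⟨S, rfl⟩ := exists_finset_sup_closure hkE h0
  choose f hf using h
  refine ⟨S.sup f, sup_le le_rt ?_⟩
  rw [Subfield.closure_le]
  exact fun x hx => rt_mono (Finset.le_sup hx) (hf x)

/-- Every finite `E / k` lies in some `k_n`, whose `r`-bases are bounded by the degree of
irrationality. -/
theorem IsQFinite.exists_rDegBounded (hq : IsQFinite k K p)
    (hpi : IsPI p (algebraMap k K).fieldRange) :
    ∃ N, RDegBounded p (algebraMap k K).fieldRange N := by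
  obtain ⟨d, hd⟩ := Cardinal.lt_aleph0.1 hq
  refine ⟨p ^ d, fun E hkE hE0 => ?_⟩
  obtain ⟨n, hn⟩ := hpi.exists_le_rt hkE hE0
  have hcard : rBaseCard k (rootField k K p n) p ≤ d :=
    (le_ciSup (f := fun n => rBaseCard k (rootField k K p n) p)
      Cardinal.bddAbove_of_small n).trans_eq hd
  obtain ⟨B, hBd, hB⟩ := exists_isRBase_of_rBaseCard_le hcard
  obtain ⟨h0, hle⟩ := relfinrank_of_isRBase (n := n) hB (by
    rintro ⟨x, a, ha⟩
    exact ⟨a, Subtype.ext ha⟩)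
  let f : rootField k K p n →+* K := (rootField k K p n).val
  have hk : (algebraMap k (rootField k K p n)).fieldRange.map f = (algebraMap k K).fieldRange := by
    rw [RingHom.map_fieldRange]
    rfl
  have htop : (⊤ : Subfield (rootField k K p n)).map f = rt p n (algebraMap k K).fieldRange := by
    ext x
    rw [Subfield.mem_map]
    exact ⟨fun ⟨y, _, h⟩ => h ▸ y.2, fun h => ⟨⟨x, h⟩, trivial, rfl⟩⟩
  rw [← Subfield.relfinrank_map_map _ _ f, hk, htop] at h0
  rw [← rdeg_map f, hk, htop] at hle
  exact (rdeg_mono hkE hn h0).trans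
    (hle.trans (Nat.pow_le_pow_right (Fact.out : p.Prime).pos hBd))

end QFinite

/-! ### Modular extensions -/

section Modular

variable {k : Type u} {K : Type v} [Field k] [Field K] [Algebra k K] {p : ℕ} [Fact p.Prime]
  [CharP K p]

theorem isModular_iff {L : IntermediateField k K} :
    IsModular L K p ↔ ∀ n, LinearDisjointOverInf (pw p n ⊤) L.toSubfield := by
  have h1 : (algebraMap L K).fieldRange = L.toSubfield := by
    ext x
    exact ⟨fun ⟨y, h⟩ => h ▸ y.2, fun h => ⟨⟨x, h⟩, rfl⟩⟩
  unfold IsModular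
  rw [h1]
  simp only [RingHom.fieldRange_eq_map]
  rfl

theorem isModular_sInf {S : Set (IntermediateField k K)} (hS : ∀ L ∈ S, IsModular L K p) :
    IsModular (sInf S : IntermediateField k K) K p := by
  rw [isModular_iff]
  intro n
  have h : (sInf S).toSubfield = sInf (IntermediateField.toSubfield '' S) := by
    ext x
    simp [Subfield.mem_sInf]
  rw [h]
  refine linearDisjointOverInf_sInf ?_
  rintro _ ⟨L, hL, rfl⟩
  exact isModular_iff.1 (hS L hL) n

theorem exists_isModular_of_subfield {L : Subfield K} (hL : (algebraMap k K).fieldRange ≤ L)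
    (h : ∀ n, LinearDisjointOverInf (pw p n ⊤) L) :
    ∃ L' : IntermediateField k K, L'.toSubfield = L ∧ IsModular L' K p :=
  ⟨L.toIntermediateField fun x => hL ⟨x, rfl⟩, rfl, isModular_iff.2 h⟩

/-- If `K ^ p ⊆ L`, then `K / L` is modular. -/
theorem linearDisjointOverInf_of_pw_one_le {L : Subfield K} (h : pw p 1 ⊤ ≤ L) (n : ℕ) :
    LinearDisjointOverInf (pw p n ⊤) L := by
  cases n with
  | zero => exact linearDisjointOverInf_of_ge (le_top.trans_eq pw_zero.symm)
  | succ n =>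
    exact linearDisjointOverInf_of_le ((pw_antitone (Nat.le_add_left 1 n)).trans h)

variable [CharP k p]

theorem hasExponent_iff_exists_pw_le :
    IsPurelyInseparable.HasExponent k K ↔ ∃ e, pw p e ⊤ ≤ (algebraMap k K).fieldRange := by
  rw [IsPurelyInseparable.hasExponent_iff' k K p]
  refine exists_congr fun e => ⟨?_, fun h a => h (mem_pw.2 ⟨a, trivial, rfl⟩)⟩
  rintro h _ ⟨x, -, rfl⟩
  exact h x

/-- A nontrivial extension of bounded exponent is modular over a proper intermediate field. -/
theorem exists_isModular_of_hasExponent (hk : (⊥ : IntermediateField k K) ≠ ⊤)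
    (h : IsPurelyInseparable.HasExponent k K) :
    ∃ L : IntermediateField k K, L ≠ ⊤ ∧ IsModular L K p := by
  obtain ⟨e, he⟩ := (hasExponent_iff_exists_pw_le (p := p)).1 h
  obtain ⟨L, hL, hmod⟩ := exists_isModular_of_subfield (k := k) (p := p)
    (L := (algebraMap k K).fieldRange ⊔ pw p 1 ⊤) le_sup_left
    (linearDisjointOverInf_of_pw_one_le le_sup_right)
  refine ⟨L, ?_, hmod⟩
  rintro rfl
  have htop := eq_top_of_pw_le hL.symm he
  refine hk (top_le_iff.1 fun x _ => ?_)
  exact IntermediateField.mem_bot.2 (htop ▸ trivial : x ∈ (algebraMap k K).fieldRange)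

/-- A `q`-finite extension of unbounded exponent is modular over some intermediate field over which
it still has unbounded exponent. -/
theorem IsQFinite.exists_isModular_not_hasExponent [IsPurelyInseparable k K]
    (hq : IsQFinite k K p) (h : ¬ IsPurelyInseparable.HasExponent k K) :
    ∃ L : IntermediateField k K, IsModular L K p ∧ ∀ e, ¬ pw p e ⊤ ≤ L.toSubfield := by
  have hpi : IsPI p (algebraMap k K).fieldRange :=
    (isPurelyInseparable_iff_pow_mem k p).1 inferInstance
  obtain ⟨N, hN⟩ := hq.exists_rDegBounded hpi
  obtain ⟨E, hkE, hE0, hperf⟩ := hN.exists_relPerfect hpi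
  have hE : E ≠ ⊤ := by
    rintro rfl
    obtain ⟨n, hn⟩ := hpi.exists_le_rt hkE hE0
    exact h (hasExponent_iff_exists_pw_le.2 ⟨n, pw_le_iff.2 hn⟩)
  obtain ⟨L, hEL, hL, hmod⟩ := exists_modular_of_relPerfect (hN.mono_left hpi hkE)
    (hpi.mono hkE) hperf hE
  obtain ⟨L', rfl, hL'⟩ := exists_isModular_of_subfield (hkE.trans hEL) hmod
  exact ⟨L', hL', fun e he => hL (eq_top_of_pw_le
    (top_le_iff.1 (hperf.symm.le.trans (sup_le_sup_right hEL _))) he)⟩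

end Modular

end PurelyInsep

/-- For a `q`-finite extension `K/k`, there is a smallest intermediate field `M` with `K/M`
modular; it is proper if `K ≠ k`, and `K/M` has unbounded exponent if `K/k` does. -/
theorem mainTheorem2 (p : ℕ) [Fact p.Prime] (k : Type u) (K : Type v) [Field k] [Field K]
    [Algebra k K] [CharP k p] [CharP K p] [IsPurelyInseparable k K]
    (hq : PurelyInsep.IsQFinite k K p) :
    ∃ M : IntermediateField k K,
      IsLeast {L : IntermediateField k K | PurelyInsep.IsModular L K p} M ∧
      ((⊥ : IntermediateField k K) ≠ ⊤ → M ≠ ⊤) ∧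
      (¬ IsPurelyInseparable.HasExponent k K → ¬ IsPurelyInseparable.HasExponent M K) := by
  set S := {L : IntermediateField k K | PurelyInsep.IsModular L K p} with hS
  have hmem : sInf S ∈ S := PurelyInsep.isModular_sInf fun L hL => hL
  have hunb : ¬ IsPurelyInseparable.HasExponent k K →
      ∀ e, ¬ PurelyInsep.pw p e ⊤ ≤ (sInf S).toSubfield := by
    intro h e he
    obtain ⟨L, hL, hLe⟩ := hq.exists_isModular_not_hasExponent h
    exact hLe e (he.trans (sInf_le hL : sInf S ≤ L))
  refine ⟨sInf S, ⟨hmem, fun L hL => sInf_le hL⟩, fun hk htop => ?_, fun h hM => ?_⟩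
  · by_cases h : IsPurelyInseparable.HasExponent k K
    · obtain ⟨L, hL, hmod⟩ := PurelyInsep.exists_isModular_of_hasExponent (p := p) hk h
      exact hL (top_le_iff.1 (htop.symm.le.trans (sInf_le hmod)))
    · refine hunb h 0 ?_
      rw [htop]
      exact le_top
  · have : CharP ↥(sInf S) p := (sInf S).val.toRingHom.charP (RingHom.injective _) p
    obtain ⟨e, he⟩ := (PurelyInsep.hasExponent_iff_exists_pw_le (p := p)).1 hM
    refine hunb h e (he.trans ?_)
    rintro _ ⟨x, rfl⟩
    exact x.2
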